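/- Theorem (retracts of the Urysohn space). Call a metric space $\mathbb{U}$ an \emph{Urysohn space} if it is complete and separable, contains an isometric copy of every separable metric space, and has the property that every isometry between finite subsets of $\mathbb{U}$ extends to a bijective isometry of $\mathbb{U}$ onto itself. An Urysohn space exists. Let $\mathbb{U}$ be any Urysohn space and let $(X,d)$ be a complete separable metric space. A map between metric spaces is \emph{non-expansive} if it does not increase distances. The following conditions are equivalent: (a) $X$ is a non-expansive retract of $\mathbb{U}$, that is, there exist an isometric embedding $i\colon X\to\mathbb{U}$ and a non-expansive map $r\colon \mathbb{U}\to X$ with $r\circ i=\mathrm{id}_X$. (b) $X$ is finitely hyperconvex, that is, for every finite family of closed balls $\overline{B}(x_0,r_0),\dots,\overline{B}(x_{n-1},r_{n-1})$ in $X$ with $\bigcap_{i<n}\overline{B}(x_i,r_i)=\emptyset$ there exist $i,j<n$ such that $d(x_i,x_j)>r_i+r_j$ (the intersection of the empty family is $X$). (b') $X$ is injective with respect to isometric embeddings of finite metric spaces, that is, for all finite metric spaces $S,T$, every isometric embedding $j\colon S\to T$ and every non-expansive map $f\colon S\to X$, there exists a non-expansive map $g\colon T\to X$ with $g\circ j=f$.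 -/

import Mathlib

/-- `U` is (a copy of) Urysohn's universal metric space: it is complete and separable, it contains
an isometric copy of every separable metric space, and every isometry between finite subsets of
`U` extends to a bijective isometry of `U`.

A separable metric space has at most continuum many points, so it is isometric to one whose
underlying type lives in `Type`; hence `universal` covers all separable metric spaces. -/
structure IsUrysohnSpace (U : Type*) [MetricSpace U] : Prop where
  complete : CompleteSpace U
  separable : TopologicalSpace.SeparableSpace U
  universal : ∀ (Y : Type) [MetricSpace Y] [TopologicalSpace.SeparableSpace Y],
    ∃ i : Y → U, Isometry i
  ultrahomogeneous : ∀ (A B : Set U), A.Finite → B.Finite → ∀ e : A ≃ᵢ B,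
    ∃ g : U ≃ᵢ U, ∀ a : A, g a = e a

/-- A map is non-expansive if it does not increase distances. -/
def NonExpansive {X Y : Type*} [MetricSpace X] [MetricSpace Y] (f : X → Y) : Prop :=
  ∀ p q : X, dist (f p) (f q) ≤ dist p q

/-- `X` is a non-expansive retract of `U`: there are an isometric embedding `i` of `X` into `U`
and a non-expansive map `r` from `U` to `X` which is a left inverse of `i`. -/
def IsNonExpansiveRetract (X U : Type*) [MetricSpace X] [MetricSpace U] : Prop :=
  ∃ (i : X → U) (r : U → X), Isometry i ∧ NonExpansive r ∧ ∀ x : X, r (i x) = x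

/-- Every finite family of closed balls with empty intersection contains two balls (possibly the
same one twice) whose centers are further apart than the sum of the radii. A negative radius gives
nothing new (take `i = j`), and the intersection of the empty family is the whole space. -/
def FinitelyHyperconvex (X : Type*) [MetricSpace X] : Prop :=
  ∀ (n : ℕ) (x : Fin n → X) (r : Fin n → ℝ),
    (⋂ i, Metric.closedBall (x i) (r i)) = ∅ → ∃ i j : Fin n, dist (x i) (x j) > r i + r j

/-- `X` is injective with respect to isometric embeddings of finite metric spaces: for every
isometric embedding `j : S → T` of finite metric spaces, every non-expansive map from `S` to `X`
extends along `j` to a non-expansive map from `T` to `X`. -/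
def InjectiveForFiniteMetricSpaces (X : Type*) [MetricSpace X] : Prop :=
  ∀ (S T : Type) [MetricSpace S] [MetricSpace T] [Finite S] [Finite T] (j : S → T),
    Isometry j → ∀ f : S → X, NonExpansive f →
      ∃ g : T → X, NonExpansive g ∧ ∀ s : S, g (j s) = f s

/-! Everything rests on `KatetovExtension`. An Urysohn space has it: universality supplies a
one-point extension and ultrahomogeneity moves it into place. Conversely, back-and-forth makes every
complete separable space with it Urysohn. Existence then reduces to a countable space with an
approximate version, which survives completion and becomes exact there.

Such a space is finitely hyperconvex, because compatible radii dominate a Katětov function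
(`exists_isKatetov_le`), and non-expansive retracts inherit this. For the converse, a copy of `X` in
`U` and the retraction are built together along dense sequences. Points of `U` get values by
hyperconvexity of `X`; each new point of the copy is put as far as possible from all earlier points,
which keeps the retraction non-expansive. -/

open Metric Set Filter Topology

/-! ### Katětov functions and their realisation -/

/-- A Katětov function: the possible distance functions to a point of a one-point extension. -/
structure IsKatetov {X : Type*} [PseudoMetricSpace X] (F : X → ℝ) : Prop where
  le_add_dist : ∀ x y, F x ≤ F y + dist x y
  dist_le_add : ∀ x y, dist x y ≤ F x + F y

/-- Every Katětov function is realised, on every finite set, as the distance to some point. -/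
def KatetovExtension (U : Type*) [PseudoMetricSpace U] : Prop :=
  ∀ F : U → ℝ, IsKatetov F → ∀ A : Set U, A.Finite → ∃ u, ∀ a ∈ A, dist u a = F a

theorem IsKatetov.nonneg {X : Type*} [PseudoMetricSpace X] {F : X → ℝ} (hF : IsKatetov F)
    (x : X) : 0 ≤ F x := by
  have := hF.dist_le_add x x
  rw [dist_self] at this
  linarith

theorem isKatetov_dist {X : Type*} [PseudoMetricSpace X] (a : X) : IsKatetov fun x => dist x a :=
  ⟨fun x y => by linarith [dist_triangle x y a], fun x y => dist_triangle_right x y a⟩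

/-- Compatible radii around finitely many points dominate a Katětov function. -/
theorem exists_isKatetov_le {X ι : Type*} [PseudoMetricSpace X] [Finite ι] (p : ι → X)
    (r : ι → ℝ) (h : ∀ i j, dist (p i) (p j) ≤ r i + r j) :
    ∃ F : X → ℝ, IsKatetov F ∧ (∀ i, F (p i) ≤ r i) ∧
      ∀ x c, Nonempty ι → (∀ i, c ≤ dist x (p i) + r i) → c ≤ F x := by
  rcases isEmpty_or_nonempty ι with hι | hι
  -- For empty `ι` the infimum used below would be the junk value 0, generally not Katětov.
  · rcases isEmpty_or_nonempty X with hX | ⟨⟨a⟩⟩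
    · exact ⟨fun x => isEmptyElim x, ⟨fun x => isEmptyElim x, fun x => isEmptyElim x⟩,
        fun i => isEmptyElim i, fun x => isEmptyElim x⟩
    · exact ⟨_, isKatetov_dist a, fun i => isEmptyElim i, fun x c ⟨i⟩ => isEmptyElim i⟩
  have hle : ∀ x i, ⨅ i, (dist x (p i) + r i) ≤ dist x (p i) + r i := fun x i =>
    ciInf_le (Set.finite_range _).bddBelow i
  -- The largest 1-Lipschitz function with value at most `r i` at each `p i`; its maximality is the
  -- last clause.
  refine ⟨fun x => ⨅ i, (dist x (p i) + r i), ⟨fun x y => ?_, fun x y => ?_⟩, fun i => ?_,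
    fun x c _ hc => le_ciInf hc⟩
  · rw [← sub_le_iff_le_add]
    refine le_ciInf fun i => ?_
    linarith [hle x i, dist_triangle x y (p i)]
  · rw [← sub_le_iff_le_add]
    refine le_ciInf fun i => ?_
    rw [sub_le_comm]
    refine le_ciInf fun j => ?_
    linarith [h i j, dist_triangle4 x (p i) (p j) y, dist_comm y (p j), dist_comm (p i) (p j)]
  · simpa using hle (p i) i

/-- A Katětov function on a finite family extends to the whole space. -/
theorem exists_isKatetov_eq {X ι : Type*} [PseudoMetricSpace X] [Finite ι] (p : ι → X)
    (r : ι → ℝ) (h : ∀ i j, dist (p i) (p j) ≤ r i + r j)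
    (h' : ∀ i j, r i ≤ dist (p i) (p j) + r j) :
    ∃ F : X → ℝ, IsKatetov F ∧ ∀ i, F (p i) = r i := by
  obtain ⟨F, hF, hle, hge⟩ := exists_isKatetov_le p r h
  exact ⟨F, hF, fun i => le_antisymm (hle i) (hge _ _ ⟨i⟩ (h' i))⟩

theorem KatetovExtension.exists_dist_eq {U ι : Type*} [PseudoMetricSpace U]
    (hU : KatetovExtension U) [Finite ι] (p : ι → U) (r : ι → ℝ)
    (h : ∀ i j, dist (p i) (p j) ≤ r i + r j) (h' : ∀ i j, r i ≤ dist (p i) (p j) + r j) :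
    ∃ u, ∀ i, dist u (p i) = r i := by
  obtain ⟨F, hF, hr⟩ := exists_isKatetov_eq p r h h'
  obtain ⟨u, hu⟩ := hU F hF (range p) (finite_range p)
  exact ⟨u, fun i => (hu _ ⟨i, rfl⟩).trans (hr i)⟩

theorem KatetovExtension.exists_dist_le {U ι : Type*} [PseudoMetricSpace U]
    (hU : KatetovExtension U) [Finite ι] (p : ι → U) (r : ι → ℝ)
    (h : ∀ i j, dist (p i) (p j) ≤ r i + r j) : ∃ u, ∀ i, dist u (p i) ≤ r i := by
  obtain ⟨F, hF, hr, -⟩ := exists_isKatetov_le p r h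
  obtain ⟨u, hu⟩ := hU F hF (range p) (finite_range p)
  exact ⟨u, fun i => (hu _ ⟨i, rfl⟩).trans_le (hr i)⟩

theorem KatetovExtension.nonempty {U : Type*} [PseudoMetricSpace U] (hU : KatetovExtension U) :
    Nonempty U :=
  let ⟨u, _⟩ := hU.exists_dist_le (Empty.elim) (Empty.elim) (fun i => i.elim)
  ⟨u⟩

/-! ### One-point extensions inside an Urysohn space -/

/-- The pseudometric on `Option ι` induced by a family of points and a Katětov function. -/
@[reducible] def optionPseudoMetric {X ι : Type*} [PseudoMetricSpace X] (p : ι → X) (F : X → ℝ)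
    (hF : IsKatetov F) : PseudoMetricSpace (Option ι) where
  dist a b := match a, b with
    | none, none => 0
    | none, some j => F (p j)
    | some i, none => F (p i)
    | some i, some j => dist (p i) (p j)
  dist_self a := by cases a <;> simp
  dist_comm a b := by cases a <;> cases b <;> simp [dist_comm]
  dist_triangle a b c := by
    have h0 := hF.nonneg
    have h1 := hF.le_add_dist
    have h2 := hF.dist_le_add
    rcases a with _ | i <;> rcases b with _ | j <;> rcases c with _ | k <;> dsimp only
    · simp
    · simp
    · linarith [h0 (p j)]
    · linarith [h1 (p k) (p j), dist_comm (p j) (p k)]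
    · simp
    · exact h2 _ _
    · linarith [h1 (p i) (p j)]
    · exact dist_triangle _ _ _

/-- A finite family and a Katětov function are realised in a finite metric space. -/
theorem exists_onePointExtension {X : Type*} [PseudoMetricSpace X] {n : ℕ} (p : Fin n → X)
    {F : X → ℝ} (hF : IsKatetov F) :
    ∃ (T : Type) (_ : MetricSpace T) (_ : Finite T) (t : T) (q : Fin n → T),
      (∀ i j, dist (q i) (q j) = dist (p i) (p j)) ∧ ∀ i, dist t (q i) = F (p i) := by
  let _ := optionPseudoMetric p F hF
  refine ⟨SeparationQuotient (Option (Fin n)), inferInstance,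
    Finite.of_surjective _ SeparationQuotient.surjective_mk, SeparationQuotient.mk none,
    fun i => SeparationQuotient.mk (some i), fun i j => ?_, fun i => ?_⟩
  · rw [SeparationQuotient.dist_mk]; rfl
  · rw [SeparationQuotient.dist_mk]; rfl

theorem exists_isometryEquiv_range {X Y ι : Type*} [MetricSpace X] [MetricSpace Y] (p : ι → X)
    (q : ι → Y) (h : ∀ i j, dist (p i) (p j) = dist (q i) (q j)) :
    ∃ e : range p ≃ᵢ range q, ∀ i, (e ⟨p i, i, rfl⟩ : Y) = q i := by
  -- Points may repeat in `p`; equality of distances makes the choice of index harmless.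
  choose s hs using fun x : range p => x.2
  have key : ∀ i, q (s ⟨p i, i, rfl⟩) = q i := fun i => by
    rw [← dist_eq_zero, ← h, hs, dist_self]
  let f : range p → range q := fun x => ⟨q (s x), s x, rfl⟩
  have hf : Isometry f := Isometry.of_dist_eq fun x y => by
    rw [Subtype.dist_eq, Subtype.dist_eq, ← h, hs, hs]
  have hsurj : Function.Surjective f := by
    rintro ⟨_, i, rfl⟩
    exact ⟨⟨p i, i, rfl⟩, Subtype.ext (key i)⟩
  exact ⟨⟨Equiv.ofBijective f ⟨hf.injective, hsurj⟩, hf⟩, key⟩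

theorem IsUrysohnSpace.katetovExtension {U : Type*} [MetricSpace U] (hU : IsUrysohnSpace U) :
    KatetovExtension U := by
  intro F hF A hA
  obtain ⟨n, p, -, rfl⟩ := hA.fin_param
  obtain ⟨T, _, _, t, q, hq, ht⟩ := exists_onePointExtension p hF
  obtain ⟨φ, hφ⟩ := hU.universal T
  obtain ⟨e, he⟩ := exists_isometryEquiv_range (φ ∘ q) p fun i j => by simp [hφ.dist_eq, hq]
  obtain ⟨g, hg⟩ := hU.ultrahomogeneous _ _ (finite_range _) (finite_range _) e
  refine ⟨g (φ t), ?_⟩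
  rintro _ ⟨i, rfl⟩
  have hgi : g (φ (q i)) = p i := (hg ⟨_, i, rfl⟩).trans (he i)
  rw [← ht i, ← hgi, g.dist_eq, hφ.dist_eq]

/-! ### Tools for back-and-forth constructions -/

/-- Recursive choice of a sequence subject to conditions on terms and on pairs of terms. -/
theorem exists_seq_of_forall_extension {α : Type*} [Nonempty α] (S : ℕ → α → Prop)
    (T : ℕ → ℕ → α → α → Prop)
    (h : ∀ n (g : ℕ → α), (∀ m < n, S m (g m)) → (∀ k < n, ∀ m < k, T m k (g m) (g k)) →
      ∃ a, S n a ∧ ∀ m < n, T m n (g m) a) :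
    ∃ g : ℕ → α, (∀ n, S n (g n)) ∧ ∀ n, ∀ m < n, T m n (g m) (g n) := by
  classical
  have a₀ : α := Classical.arbitrary α
  choose! F hF using h
  let G : ∀ n, (∀ m < n, α) → α := fun n f => F n fun m => if hm : m < n then f m hm else a₀
  let g : ℕ → α := Nat.lt_wfRel.wf.fix G
  have hg : ∀ n, g n = F n fun m => if m < n then g m else a₀ := fun n =>
    Nat.lt_wfRel.wf.fix_eq G n
  have key : ∀ n, S n (g n) ∧ ∀ m < n, T m n (g m) (g n) := by
    intro n
    induction n using Nat.strong_induction_on with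
    | _ n ih =>
      have := hF n (fun m => if m < n then g m else a₀)
        (fun m hm => by simpa only [if_pos hm] using (ih m hm).1)
        (fun k hk m hm => by
          simpa only [if_pos hk, if_pos (hm.trans hk)] using (ih k hk).2 m hm)
      rw [← hg] at this
      exact ⟨this.1, fun m hm => by simpa only [if_pos hm] using this.2 m hm⟩
  exact ⟨g, fun n => (key n).1, fun n => (key n).2⟩

theorem NonExpansive.lipschitzWith {X Y : Type*} [MetricSpace X] [MetricSpace Y] {f : X → Y}
    (hf : NonExpansive f) : LipschitzWith 1 f :=
  LipschitzWith.of_dist_le_mul fun p q => by simpa using hf p q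

/-- A non-expansive map from a dense sequence to a complete space extends. -/
theorem exists_nonExpansive_extension {X Y : Type*} [MetricSpace X] [MetricSpace Y]
    [CompleteSpace Y] {x : ℕ → X} (hx : DenseRange x) (y : ℕ → Y)
    (h : ∀ m n, dist (y m) (y n) ≤ dist (x m) (x n)) :
    ∃ g : X → Y, NonExpansive g ∧ ∀ n, g (x n) = y n := by
  choose s hs using fun a : range x => a.2
  let f : range x → Y := fun a => y (s a)
  have hf : NonExpansive f := fun a b => by
    rw [Subtype.dist_eq, ← hs a, ← hs b]
    exact h _ _
  have hu : IsUniformInducing (Subtype.val : range x → X) := isUniformInducing_val _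
  have hd : DenseRange (Subtype.val : range x → X) := by rwa [DenseRange, Subtype.range_coe]
  have huf := hf.lipschitzWith.uniformContinuous
  let g := (hu.isDenseInducing hd).extend f
  have hgc : Continuous g := (uniformContinuous_uniformly_extend hu hd huf).continuous
  have hg : ∀ n, g (x n) = y n := fun n => by
    refine (uniformly_extend_of_ind hu hd huf ⟨x n, n, rfl⟩).trans (dist_le_zero.1 ?_)
    exact (h _ _).trans_eq (by rw [hs, dist_self])
  refine ⟨g, fun a b => ?_, hg⟩
  refine hx.induction_on₂ (p := fun a b => dist (g a) (g b) ≤ dist a b)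
    (isClosed_le (by fun_prop) (by fun_prop)) (fun m n => ?_) a b
  rw [hg, hg]
  exact h m n

/-- An isometry from a dense sequence to a complete space extends. -/
theorem exists_isometry_extension {X Y : Type*} [MetricSpace X] [MetricSpace Y]
    [CompleteSpace Y] {x : ℕ → X} (hx : DenseRange x) (y : ℕ → Y)
    (h : ∀ m n, dist (y m) (y n) = dist (x m) (x n)) :
    ∃ g : X → Y, Isometry g ∧ ∀ n, g (x n) = y n := by
  obtain ⟨g, hg, hgx⟩ := exists_nonExpansive_extension hx y fun m n => (h m n).le
  have hgc := hg.lipschitzWith.continuous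
  refine ⟨g, Isometry.of_dist_eq fun a b => ?_, hgx⟩
  refine hx.induction_on₂ (p := fun a b => dist (g a) (g b) = dist a b)
    (isClosed_eq (by fun_prop) (by fun_prop)) (fun m n => ?_) a b
  rw [hgx, hgx]
  exact h m n

/-! ### Finite hyperconvexity, retracts and finite injectivity -/

theorem finitelyHyperconvex_iff {X : Type*} [MetricSpace X] :
    FinitelyHyperconvex X ↔ ∀ (n : ℕ) (x : Fin n → X) (r : Fin n → ℝ),
      (∀ i j, dist (x i) (x j) ≤ r i + r j) → ∃ a, ∀ i, dist a (x i) ≤ r i := by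
  refine forall₃_congr fun n x r => ?_
  rw [← not_imp_not]
  simp [← Set.nonempty_iff_ne_empty, Set.Nonempty]

theorem FinitelyHyperconvex.exists_dist_le {X ι : Type*} [MetricSpace X]
    (hX : FinitelyHyperconvex X) [Finite ι] (x : ι → X) (r : ι → ℝ)
    (h : ∀ i j, dist (x i) (x j) ≤ r i + r j) : ∃ a, ∀ i, dist a (x i) ≤ r i := by
  obtain ⟨n, ⟨e⟩⟩ := Finite.exists_equiv_fin ι
  obtain ⟨a, ha⟩ := finitelyHyperconvex_iff.1 hX n (x ∘ e.symm) (r ∘ e.symm) fun i j => h _ _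
  exact ⟨a, fun i => by simpa using ha (e i)⟩

theorem FinitelyHyperconvex.nonempty {X : Type*} [MetricSpace X] (hX : FinitelyHyperconvex X) :
    Nonempty X :=
  let ⟨a, _⟩ := hX.exists_dist_le (Empty.elim) (Empty.elim) (fun i => i.elim)
  ⟨a⟩

theorem IsNonExpansiveRetract.finitelyHyperconvex {X U : Type*} [MetricSpace X] [MetricSpace U]
    (hU : KatetovExtension U) (h : IsNonExpansiveRetract X U) : FinitelyHyperconvex X := by
  obtain ⟨i, r, hi, hr, hri⟩ := h
  refine finitelyHyperconvex_iff.2 fun n x ρ hx => ?_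
  obtain ⟨u, hu⟩ := hU.exists_dist_le (i ∘ x) ρ fun k l => by simpa [hi.dist_eq] using hx k l
  exact ⟨r u, fun k => by simpa [hri] using (hr u (i (x k))).trans (hu k)⟩

/-- Points of `T` are added one at a time: the admissible values at `t` form the intersection of the
balls of radius `dist t b` about `g b`, which are compatible by the triangle inequality. -/
theorem FinitelyHyperconvex.injectiveForFiniteMetricSpaces {X : Type*} [MetricSpace X]
    (hX : FinitelyHyperconvex X) : InjectiveForFiniteMetricSpaces X := by
  classical
  intro S T _ _ _ _ j hj f hf
  have := hX.nonempty
  have key : ∀ s : Finset T, ∃ g : T → X, (∀ x, g (j x) = f x) ∧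
      ∀ a ∈ range j ∪ s, ∀ b ∈ range j ∪ s, dist (g a) (g b) ≤ dist a b := by
    intro s
    induction s using Finset.induction_on with
    | empty =>
      refine ⟨Function.extend j f fun _ => Classical.arbitrary X,
        fun x => hj.injective.extend_apply _ _ _, ?_⟩
      simp only [Finset.coe_empty, union_empty]
      rintro _ ⟨x, rfl⟩ _ ⟨y, rfl⟩
      rw [hj.injective.extend_apply, hj.injective.extend_apply, hj.dist_eq]
      exact hf x y
    | insert t s _ ih =>
      obtain ⟨g, hg, hgs⟩ := ih
      by_cases ht : t ∈ range j ∪ s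
      · refine ⟨g, hg, ?_⟩
        rwa [Finset.coe_insert, union_insert, insert_eq_of_mem ht]
      obtain ⟨a, ha⟩ := hX.exists_dist_le (fun b : ↥(range j ∪ (s : Set T)) => g b)
        (fun b => dist t b) fun b c => (hgs b b.2 c c.2).trans (dist_triangle_left _ _ _)
      have hne : ∀ b ∈ range j ∪ (s : Set T), b ≠ t := fun b hb h => ht (h ▸ hb)
      refine ⟨Function.update g t a, fun x => ?_, ?_⟩
      · rw [Function.update_of_ne (hne _ (Or.inl ⟨x, rfl⟩)), hg]
      rw [Finset.coe_insert, union_insert]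
      rintro b (rfl | hb) c (rfl | hc)
      · simp
      · rw [Function.update_self, Function.update_of_ne (hne c hc)]
        exact ha ⟨c, hc⟩
      · rw [Function.update_self, Function.update_of_ne (hne b hb), dist_comm, dist_comm b]
        exact ha ⟨b, hb⟩
      · rw [Function.update_of_ne (hne b hb), Function.update_of_ne (hne c hc)]
        exact hgs b hb c hc
  have := Fintype.ofFinite T
  obtain ⟨g, hg, hgs⟩ := key Finset.univ
  exact ⟨g, fun a b => hgs a (by simp) b (by simp), hg⟩

/-- The centres and a Katětov function below the radii give a one-point extension; a non-expansive
map fixing the centres sends the new point into every ball. -/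
theorem InjectiveForFiniteMetricSpaces.finitelyHyperconvex {X : Type*} [MetricSpace X]
    (hX : InjectiveForFiniteMetricSpaces X) : FinitelyHyperconvex X := by
  refine finitelyHyperconvex_iff.2 fun n x r h => ?_
  obtain ⟨F, hF, hFr, -⟩ := exists_isKatetov_le x r h
  obtain ⟨T, _, _, t, q, hq, ht⟩ := exists_onePointExtension x hF
  obtain ⟨e, he⟩ := exists_isometryEquiv_range q x hq
  obtain ⟨g, hg, hgq⟩ := hX (range q) T Subtype.val isometry_subtype_coe (fun s => e s)
    fun a b => (e.isometry.dist_eq a b).le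
  refine ⟨g t, fun i => ?_⟩
  rw [← he i, ← hgq]
  exact (hg _ _).trans ((ht i).trans_le (hFr i))

/-! ### Simultaneous construction of the embedding and the retraction -/

/-- A finitely hyperconvex Polish metric space is a retract of any separable space with the
Katětov extension property. -/
theorem FinitelyHyperconvex.isNonExpansiveRetract {X U : Type*} [MetricSpace X] [CompleteSpace X]
    [TopologicalSpace.SeparableSpace X] [MetricSpace U] [CompleteSpace U]
    [TopologicalSpace.SeparableSpace U] (hX : FinitelyHyperconvex X) (hU : KatetovExtension U) :
    IsNonExpansiveRetract X U := by
  have := hX.nonempty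
  have := hU.nonempty
  obtain ⟨x, hx⟩ := TopologicalSpace.exists_dense_seq X
  obtain ⟨d, hd⟩ := TopologicalSpace.exists_dense_seq U
  obtain ⟨g, hgS, hgT⟩ := exists_seq_of_forall_extension (α := U × X)
    (fun n a => if Even n then a.2 = x (n / 2) else a.1 = d (n / 2))
    (fun m n a b => dist a.2 b.2 ≤ dist a.1 b.1 ∧
      (Even m → Even n → dist a.1 b.1 = dist a.2 b.2)) (by
    intro n g hS hT
    have hT1 : ∀ k l : Fin n, dist (g k).2 (g l).2 ≤ dist (g k).1 (g l).1 := by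
      intro k l
      rcases lt_trichotomy (k : ℕ) l with h | h | h
      · exact (hT l l.2 k h).1
      · simp [h]
      · rw [dist_comm, dist_comm (g k).1]
        exact (hT k k.2 l h).1
    have hT2 : ∀ k l : Fin n, Even (k : ℕ) → Even (l : ℕ) →
        dist (g k).1 (g l).1 = dist (g k).2 (g l).2 := by
      intro k l hk hl
      rcases lt_trichotomy (k : ℕ) l with h | h | h
      · exact (hT l l.2 k h).2 hk hl
      · simp [h]
      · rw [dist_comm, dist_comm (g k).2]
        exact (hT k k.2 l h).2 hl hk
    by_cases hn : Even n
    -- Even indices form the copy of `X`. They alone determine `F`, but `F` is realised on all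
    -- earlier points.
    · let ι := {k : Fin n // Even (k : ℕ)}
      let r : ι → ℝ := fun k => dist (x (n / 2)) (g k).2
      have hr : ∀ k l : ι, dist (g k).1 (g l).1 ≤ r k + r l := fun k l =>
        (hT2 _ _ k.2 l.2).trans_le (dist_triangle_left _ _ _)
      obtain ⟨F, hF, hFr, hFc⟩ := exists_isKatetov_le (fun k : ι => (g k).1) r hr
      obtain ⟨u, hu⟩ := hU F hF (range fun k : Fin n => (g k).1) (finite_range _)
      refine ⟨(u, x (n / 2)), by simp [hn], fun m hm => ?_⟩
      have hum := hu _ ⟨⟨m, hm⟩, rfl⟩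
      -- Non-expansiveness towards odd points too: `F` is the largest choice, and each term of its
      -- infimum is at least the required distance.
      have key : dist (x (n / 2)) (g m).2 ≤ F (g m).1 := by
        refine hFc _ _ ⟨⟨⟨0, by omega⟩, by simp⟩⟩ fun k => ?_
        have := hT1 ⟨m, hm⟩ k
        dsimp only at this
        linarith [dist_triangle_right (x (n / 2)) (g m).2 (g k).2]
      dsimp only at hum ⊢
      rw [dist_comm, dist_comm (g m).1, hum]
      refine ⟨key, fun hme _ => le_antisymm (hFr ⟨⟨m, hm⟩, hme⟩) key⟩
    · obtain ⟨a, ha⟩ := hX.exists_dist_le (fun k : Fin n => (g k).2)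
        (fun k => dist (d (n / 2)) (g k).1)
        fun k l => (hT1 k l).trans (dist_triangle_left _ _ _)
      refine ⟨(d (n / 2), a), by simp [hn], fun m hm => ⟨?_, fun _ h => absurd h hn⟩⟩
      rw [dist_comm, dist_comm _ (d _)]
      exact ha ⟨m, hm⟩)
  have hS0 : ∀ k, (g (2 * k)).2 = x k := fun k => by simpa using hgS (2 * k)
  have hS1 : ∀ k, (g (2 * k + 1)).1 = d k := fun k => by
    have := hgS (2 * k + 1)
    rwa [if_neg (by simp), show (2 * k + 1) / 2 = k by omega] at this
  have hT1 : ∀ k l, dist (g k).2 (g l).2 ≤ dist (g k).1 (g l).1 := by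
    intro k l
    rcases lt_trichotomy k l with h | h | h
    · exact (hgT l k h).1
    · simp [h]
    · rw [dist_comm, dist_comm (g k).1]
      exact (hgT k l h).1
  have hT2 : ∀ k l, dist (g (2 * k)).1 (g (2 * l)).1 = dist (x k) (x l) := by
    intro k l
    rw [← hS0, ← hS0]
    rcases lt_trichotomy k l with h | h | h
    · exact (hgT (2 * l) (2 * k) (by omega)).2 (by simp) (by simp)
    · simp [h]
    · rw [dist_comm, dist_comm (g _).2]
      exact (hgT (2 * k) (2 * l) (by omega)).2 (by simp) (by simp)
  obtain ⟨i, hi, hix⟩ := exists_isometry_extension hx (fun k => (g (2 * k)).1) hT2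
  have hgd : DenseRange fun k => (g k).1 := by
    refine hd.mono ?_
    rintro _ ⟨k, rfl⟩
    exact ⟨2 * k + 1, hS1 k⟩
  obtain ⟨r, hr, hrg⟩ := exists_nonExpansive_extension hgd (fun k => (g k).2) hT1
  refine ⟨i, r, hi, hr, fun a => ?_⟩
  have h1 := hr.lipschitzWith.continuous.comp hi.continuous
  refine congrFun (hx.equalizer h1 continuous_id (funext fun k => ?_)) a
  simp only [Function.comp_apply, hix, hrg, hS0, id]

/-! ### Universality and ultrahomogeneity from Katětov extension -/

theorem KatetovExtension.exists_isometry {U Y : Type*} [MetricSpace U] [CompleteSpace U]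
    (hU : KatetovExtension U) [MetricSpace Y] [TopologicalSpace.SeparableSpace Y] :
    ∃ i : Y → U, Isometry i := by
  rcases isEmpty_or_nonempty Y with hY | hY
  · exact ⟨fun y => isEmptyElim y, fun y => isEmptyElim y⟩
  have := hU.nonempty
  obtain ⟨y, hy⟩ := TopologicalSpace.exists_dense_seq Y
  obtain ⟨g, -, hg⟩ := exists_seq_of_forall_extension (α := U) (fun _ _ => True)
    (fun m n a b => dist a b = dist (y m) (y n)) (by
    intro n g _ hT
    have hT' : ∀ k l : Fin n, dist (g k) (g l) = dist (y k) (y l) := by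
      intro k l
      rcases lt_trichotomy (k : ℕ) l with h | h | h
      · exact hT l l.2 k h
      · simp [h]
      · rw [dist_comm, dist_comm (y k)]
        exact hT k k.2 l h
    obtain ⟨u, hu⟩ := hU.exists_dist_eq (fun k : Fin n => g k) (fun k => dist (y k) (y n))
      (fun k l => (hT' k l).trans_le (dist_triangle_right _ _ _))
      (fun k l => by rw [hT']; exact dist_triangle _ _ _)
    exact ⟨u, trivial, fun m hm => (dist_comm _ _).trans (hu ⟨m, hm⟩)⟩)
  obtain ⟨i, hi, -⟩ := exists_isometry_extension hy g fun m n => by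
    rcases lt_trichotomy m n with h | h | h
    · exact hg n m h
    · simp [h]
    · rw [dist_comm, dist_comm (y m)]
      exact hg m n h
  exact ⟨i, hi⟩

theorem KatetovExtension.exists_isometryEquiv_extension {U : Type*} [MetricSpace U]
    [CompleteSpace U] [TopologicalSpace.SeparableSpace U] (hU : KatetovExtension U)
    {ι : Type*} [Finite ι] (p q : ι → U) (h : ∀ i j, dist (p i) (p j) = dist (q i) (q j)) :
    ∃ g : U ≃ᵢ U, ∀ i, g (p i) = q i := by
  have := hU.nonempty
  obtain ⟨d, hd⟩ := TopologicalSpace.exists_dense_seq U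
  have step : ∀ (κ : Type _) [Finite κ] (a b : κ → U),
      (∀ i j, dist (a i) (a j) = dist (b i) (b j)) → ∀ x, ∃ y, ∀ i, dist x (a i) = dist y (b i) := by
    intro κ _ a b hab x
    obtain ⟨y, hy⟩ := hU.exists_dist_eq b (fun i => dist x (a i))
      (fun i j => by rw [← hab]; exact dist_triangle_left _ _ _)
      (fun i j => by rw [← hab, add_comm, dist_comm (a i)]; exact dist_triangle _ _ _)
    exact ⟨y, fun i => (hy i).symm⟩
  obtain ⟨g, hgS, hgT⟩ := exists_seq_of_forall_extension (α := U × U)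
    (fun n a => (if Even n then a.1 = d (n / 2) else a.2 = d (n / 2)) ∧
      ∀ i, dist a.1 (p i) = dist a.2 (q i))
    (fun m n a b => dist a.1 b.1 = dist a.2 b.2) (by
    intro n g hS hT
    have hT' : ∀ k l : Fin n, dist (g k).1 (g l).1 = dist (g k).2 (g l).2 := by
      intro k l
      rcases lt_trichotomy (k : ℕ) l with h | h | h
      · exact hT l l.2 k h
      · simp [h]
      · rw [dist_comm, dist_comm (g k).2]
        exact hT k k.2 l h
    let a : ι ⊕ Fin n → U := Sum.elim p fun k => (g k).1
    let b : ι ⊕ Fin n → U := Sum.elim q fun k => (g k).2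
    have hab : ∀ i j, dist (a i) (a j) = dist (b i) (b j) := by
      rintro (i | i) (j | j)
      · exact h i j
      · have := (hS j j.2).2 i
        rwa [dist_comm, dist_comm _ (q i)] at this
      · exact (hS i i.2).2 j
      · exact hT' i j
    by_cases hn : Even n
    · obtain ⟨y, hy⟩ := step _ a b hab (d (n / 2))
      refine ⟨(d (n / 2), y), ⟨by simp [hn], fun i => hy (Sum.inl i)⟩, fun m hm => ?_⟩
      rw [dist_comm, dist_comm (g m).2]
      exact hy (Sum.inr ⟨m, hm⟩)
    · obtain ⟨y, hy⟩ := step _ b a (fun i j => (hab i j).symm) (d (n / 2))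
      refine ⟨(y, d (n / 2)), ⟨by simp [hn], fun i => (hy (Sum.inl i)).symm⟩, fun m hm => ?_⟩
      rw [dist_comm, dist_comm (g m).2]
      exact (hy (Sum.inr ⟨m, hm⟩)).symm)
  have hT : ∀ k l, dist (g k).2 (g l).2 = dist (g k).1 (g l).1 := by
    intro k l
    rcases lt_trichotomy k l with h | h | h
    · exact (hgT l k h).symm
    · simp [h]
    · rw [dist_comm, dist_comm (g k).1]
      exact (hgT k l h).symm
  have h1 : DenseRange fun k => (g k).1 := by
    refine hd.mono ?_
    rintro _ ⟨k, rfl⟩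
    exact ⟨2 * k, by simpa using (hgS (2 * k)).1⟩
  have h2 : DenseRange fun k => (g k).2 := by
    refine hd.mono ?_
    rintro _ ⟨k, rfl⟩
    have := (hgS (2 * k + 1)).1
    rw [if_neg (by simp), show (2 * k + 1) / 2 = k by omega] at this
    exact ⟨2 * k + 1, this⟩
  obtain ⟨f, hf, hfg⟩ := exists_isometry_extension h1 (fun k => (g k).2) hT
  have hsurj : Function.Surjective f := by
    rw [← range_eq_univ, ← hf.isClosedEmbedding.isClosed_range.closure_eq, ← dense_iff_closure_eq]
    refine h2.mono ?_
    rintro _ ⟨k, rfl⟩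
    exact ⟨_, hfg k⟩
  refine ⟨⟨Equiv.ofBijective f ⟨hf.injective, hsurj⟩, hf⟩, fun i => ?_⟩
  have hfc := hf.continuous
  -- The `p i` need not occur in the sequence; equality of distances passes to the limit and is then
  -- evaluated at `p i`.
  have key : (fun x => dist (f x) (q i)) = fun x => dist x (p i) :=
    h1.equalizer (by fun_prop) (by fun_prop) (funext fun k => by
      simp only [Function.comp_apply, hfg]
      exact ((hgS k).2 i).symm)
  have := congrFun key (p i)
  rwa [dist_self, dist_eq_zero] at this

theorem KatetovExtension.isUrysohnSpace {U : Type*} [MetricSpace U] [CompleteSpace U]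
    [TopologicalSpace.SeparableSpace U] (hU : KatetovExtension U) : IsUrysohnSpace U where
  complete := inferInstance
  separable := inferInstance
  universal _ _ _ := hU.exists_isometry
  ultrahomogeneous A B hA _ e := by
    have := hA.to_subtype
    obtain ⟨g, hg⟩ := hU.exists_isometryEquiv_extension (fun a : A => (a : U))
      (fun a => (e a : U)) fun a b => (e.isometry.dist_eq a b).symm
    exact ⟨g, hg⟩

/-! ### From approximate to exact extension -/

/-- Every Katětov function is approximately realised on finite sets. -/
def ApproxKatetovExtension (U : Type*) [PseudoMetricSpace U] : Prop :=
  ∀ F : U → ℝ, IsKatetov F → ∀ A : Set U, A.Finite → ∀ ε > 0,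
    ∃ u, ∀ a ∈ A, |dist u a - F a| ≤ ε

theorem ApproxKatetovExtension.of_denseRange {D U : Type*} [PseudoMetricSpace D]
    [PseudoMetricSpace U] (hD : ApproxKatetovExtension D) {φ : D → U} (hφ : Isometry φ)
    (hd : DenseRange φ) : ApproxKatetovExtension U := by
  intro F hF A hA ε hε
  choose s hs using fun a => hd.exists_dist_lt a (show 0 < ε / 3 by linarith)
  have hFφ : IsKatetov (F ∘ φ) := ⟨fun x y => by
    rw [← hφ.dist_eq]; exact hF.le_add_dist _ _, fun x y => by
    rw [← hφ.dist_eq]; exact hF.dist_le_add _ _⟩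
  obtain ⟨u, hu⟩ := hD _ hFφ (s '' A) (hA.image s) (ε / 3) (by linarith)
  refine ⟨φ u, fun a ha => ?_⟩
  have h1 := abs_le.1 (hu _ ⟨a, ha, rfl⟩)
  rw [← hφ.dist_eq, Function.comp_apply] at h1
  have h2 := hs a
  have h3 := hF.le_add_dist a (φ (s a))
  have h4 := hF.le_add_dist (φ (s a)) a
  have h5 := dist_triangle (φ u) (φ (s a)) a
  have h6 := dist_triangle (φ u) a (φ (s a))
  rw [dist_comm (φ (s a)) a] at h4 h5
  rw [abs_le]
  constructor <;> linarith [h1.1, h1.2]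

theorem ApproxKatetovExtension.katetovExtension {U : Type*} [MetricSpace U] [CompleteSpace U]
    (hU : ApproxKatetovExtension U) : KatetovExtension U := by
  intro F hF A hA
  obtain ⟨u₀, hu₀⟩ := hU F hF A hA 1 one_pos
  have : Nonempty U := ⟨u₀⟩
  obtain ⟨g, hg, hgT⟩ := exists_seq_of_forall_extension (α := U)
    (fun n u => ∀ a ∈ A, |dist u a - F a| ≤ (1 / 2) ^ n)
    (fun m n u v => n = m + 1 → dist u v ≤ 2 * (1 / 2) ^ m) (by
    rintro (_ | n) g hS -
    · exact ⟨u₀, by simpa using hu₀, by simp⟩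
    have hSn := hS n n.lt_succ_self
    have := hA.to_subtype
    have hpos : (0 : ℝ) < (1 / 2) ^ n := by positivity
    -- Since `g n` realises `F` up to `(1 / 2) ^ n`, the value `(1 / 2) ^ n` at `g n` is compatible
    -- with `F` on `A`. Realising `G` thus improves the error while staying near `g n`, so the
    -- sequence is Cauchy.
    obtain ⟨G, hG, hGr, hGc⟩ := exists_isKatetov_le
      (fun o : Option A => o.elim (g n) Subtype.val) (fun o => o.elim ((1 / 2) ^ n) fun a => F a) (by
      rintro (_ | a) (_ | b)
      · simp
      · have := (abs_le.1 (hSn b b.2)).2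
        simp only [Option.elim]
        linarith
      · have := (abs_le.1 (hSn a a.2)).2
        simp only [Option.elim]
        rw [dist_comm]
        linarith
      · exact hF.dist_le_add _ _)
    have hGF : ∀ a ∈ A, G a = F a := fun a ha => by
      refine le_antisymm (hGr (some ⟨a, ha⟩)) (hGc _ _ inferInstance ?_)
      rintro (_ | b)
      · have := (abs_le.1 (hSn a ha)).1
        simp only [Option.elim]
        rw [dist_comm]
        linarith
      · simp only [Option.elim]
        linarith [hF.le_add_dist a b]
    obtain ⟨u, hu⟩ := hU G hG (insert (g n) A) (hA.insert _) ((1 / 2) ^ (n + 1)) (by positivity)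
    refine ⟨u, fun a ha => ?_, ?_⟩
    · rw [← hGF a ha]
      exact hu a (Or.inr ha)
    · rintro m - h
      obtain rfl : n = m := by omega
      have h1 := (abs_le.1 (hu _ (Or.inl rfl))).2
      have h2 : G (g n) ≤ (1 / 2) ^ n := hGr none
      rw [pow_succ] at h1
      rw [dist_comm]
      linarith)
  have hc : CauchySeq g := cauchySeq_of_le_geometric (1 / 2) 2 (by norm_num) fun n =>
    hgT (n + 1) n n.lt_succ_self rfl
  obtain ⟨u, hu⟩ := cauchySeq_tendsto_of_complete hc
  refine ⟨u, fun a ha => ?_⟩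
  have h1 : Tendsto (fun n => |dist (g n) a - F a|) atTop (𝓝 |dist u a - F a|) :=
    ((hu.dist tendsto_const_nhds).sub_const _).abs
  have h2 : Tendsto (fun n : ℕ => ((1 / 2 : ℝ)) ^ n) atTop (𝓝 0) :=
    tendsto_pow_atTop_nhds_zero_of_lt_one (by norm_num) (by norm_num)
  have h3 := le_of_tendsto_of_tendsto' h1 h2 fun n => hg n a ha
  exact sub_eq_zero.1 (abs_nonpos_iff.1 h3)

/-! ### A countable space with approximate extension -/

/-- The axioms of a pseudometric, for a bare function. -/
structure IsPseudoDist {α : Type*} (δ : α → α → ℝ) : Prop where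
  self : ∀ x, δ x x = 0
  comm : ∀ x y, δ x y = δ y x
  triangle : ∀ x y z, δ x z ≤ δ x y + δ y z

/-- The pseudometric space given by a pseudometric. -/
@[reducible] def IsPseudoDist.toPseudoMetricSpace {α : Type*} {δ : α → α → ℝ}
    (hδ : IsPseudoDist δ) : PseudoMetricSpace α where
  dist := δ
  dist_self := hδ.self
  dist_comm := hδ.comm
  dist_triangle := hδ.triangle

/-- The point `N` is moved so that its distances to the first `n ≤ N` points become as large as
compatible radii `q` permit. -/
theorem IsPseudoDist.exists_step {δ : ℕ → ℕ → ℝ} (hδ : IsPseudoDist δ) (N : ℕ)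
    (τ : Σ n, Fin n → ℚ) :
    ∃ δ' : ℕ → ℕ → ℝ, IsPseudoDist δ' ∧ (∀ i < N, ∀ j < N, δ' i j = δ i j) ∧
      (τ.1 ≤ N → (∀ i j : Fin τ.1, δ i j ≤ τ.2 i + τ.2 j) → ∀ i : Fin τ.1,
        δ' N i ≤ τ.2 i ∧ ∀ c, (∀ k : Fin τ.1, c ≤ δ i k + τ.2 k) → c ≤ δ' N i) := by
  obtain ⟨n, q⟩ := τ
  by_cases hq : ∀ i j : Fin n, δ i j ≤ q i + q j
  swap
  · exact ⟨δ, hδ, fun _ _ _ _ => rfl, fun _ h => absurd h hq⟩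
  obtain ⟨f, hf, hfq, hfc⟩ := @exists_isKatetov_le ℕ (Fin n) hδ.toPseudoMetricSpace _
    (fun i => i) (fun i => q i) hq
  have h0 := @IsKatetov.nonneg ℕ hδ.toPseudoMetricSpace f hf
  have h1 : ∀ x y, f x ≤ f y + δ x y := @IsKatetov.le_add_dist ℕ hδ.toPseudoMetricSpace f hf
  have h2 : ∀ x y, δ x y ≤ f x + f y := @IsKatetov.dist_le_add ℕ hδ.toPseudoMetricSpace f hf
  have hc := hδ.comm
  -- The old point `N` is discarded and replaced by one at distances `f` from the others.
  refine ⟨fun i j => if i = N then if j = N then 0 else f j else if j = N then f i else δ i j,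
    ⟨fun x => ?_, fun x y => ?_, fun x y z => ?_⟩, fun i hi j hj => ?_, fun hn _ i => ?_⟩
  · by_cases hx : x = N <;> simp [hx, hδ.self]
  · by_cases hx : x = N <;> by_cases hy : y = N <;> simp [hx, hy, hc x y]
  · by_cases hx : x = N <;> by_cases hy : y = N <;> by_cases hz : z = N <;>
      simp only [hx, hy, hz, if_true, if_false]
    · simp
    · simp
    · linarith [h0 y]
    · linarith [h1 z y, hc z y]
    · simp
    · exact h2 _ _
    · linarith [h1 x y]
    · exact hδ.triangle _ _ _
  · simp only [if_neg hi.ne, if_neg hj.ne]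
  · have hi : (i : ℕ) ≠ N := by have := i.2; dsimp only at this hn; omega
    simp only [if_true, if_neg hi]
    exact ⟨hfq i, fun c hcc => hfc _ _ ⟨i⟩ hcc⟩

/-- There are countably many rational tasks, one per stage. Stage `N` preserves distances among
points below `N`, so every distance stabilises. -/
theorem exists_pseudoDist_nat : ∃ d : ℕ → ℕ → ℝ, IsPseudoDist d ∧
    ∀ n (q : Fin n → ℚ), (∀ i j : Fin n, d i j ≤ q i + q j) →
      ∃ N, ∀ i : Fin n, d N i ≤ q i ∧ ∀ c, (∀ k : Fin n, c ≤ d i k + q k) → c ≤ d N i := by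
  obtain ⟨e, he⟩ := exists_surjective_nat (Σ n, Fin n → ℚ)
  have step : ∀ (N : ℕ) (δ : {δ : ℕ → ℕ → ℝ // IsPseudoDist δ}), ∃ δ' : {δ // IsPseudoDist δ},
      (∀ i < N, ∀ j < N, δ'.1 i j = δ.1 i j) ∧ ∀ n (q : Fin n → ℚ), e N.unpair.1 = ⟨n, q⟩ →
        n ≤ N → (∀ i j : Fin n, δ.1 i j ≤ q i + q j) → ∀ i : Fin n,
        δ'.1 N i ≤ q i ∧ ∀ c, (∀ k : Fin n, c ≤ δ.1 i k + q k) → c ≤ δ'.1 N i := by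
    intro N δ
    obtain ⟨δ', h1, h2, h3⟩ := δ.2.exists_step N (e N.unpair.1)
    refine ⟨⟨δ', h1⟩, h2, fun n q h => ?_⟩
    rw [h] at h3
    exact h3
  choose next hagree htask using step
  let s : ℕ → {δ : ℕ → ℕ → ℝ // IsPseudoDist δ} := fun n =>
    n.rec ⟨fun _ _ => 0, fun _ => rfl, fun _ _ => rfl, fun _ _ _ => by simp⟩ next
  have hstab : ∀ N M, N ≤ M → ∀ i < N, ∀ j < N, (s M).1 i j = (s N).1 i j := by
    intro N M hM
    induction M, hM using Nat.le_induction with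
    | base => exact fun _ _ _ _ => rfl
    | succ M hM ih =>
      exact fun i hi j hj =>
        (hagree M (s M) i (hi.trans_le hM) j (hj.trans_le hM)).trans (ih i hi j hj)
  let d : ℕ → ℕ → ℝ := fun i j => (s (max i j + 1)).1 i j
  have hd : ∀ N, ∀ i < N, ∀ j < N, d i j = (s N).1 i j := fun N i hi j hj =>
    (hstab (max i j + 1) N (by omega) i (by omega) j (by omega)).symm
  refine ⟨d, ⟨fun x => (s (max x x + 1)).2.self x,
    fun x y => ?_, fun x y z => ?_⟩, fun n q hq => ?_⟩
  · rw [hd (max x y + 1) x (by omega) y (by omega), hd (max x y + 1) y (by omega) x (by omega)]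
    exact (s (max x y + 1)).2.comm x y
  · let N := max (max x y) z + 1
    rw [hd N x (by omega) y (by omega), hd N x (by omega) z (by omega),
      hd N y (by omega) z (by omega)]
    exact (s N).2.triangle x y z
  · obtain ⟨k, hk⟩ := he ⟨n, q⟩
    -- Pairing with `n` forces `n ≤ N`: the points of the task are settled when it is performed.
    let N := Nat.pair k n
    have hnN : n ≤ N := Nat.right_le_pair k n
    have hlt : ∀ i : Fin n, (i : ℕ) < N := fun i => i.2.trans_le hnN
    have hN := htask N (s N) n q (by rw [Nat.unpair_pair, hk]) hnN fun i j => by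
      rw [← hd N i (hlt i) j (hlt j)]
      exact hq i j
    refine ⟨N, fun i => ?_⟩
    have hdN : d N i = (next N (s N)).1 N i :=
      hd (N + 1) N (Nat.lt_succ_self N) i ((hlt i).trans (Nat.lt_succ_self N))
    rw [hdN]
    refine ⟨(hN i).1, fun c hc => (hN i).2 c fun k => ?_⟩
    rw [← hd N i (hlt i) k (hlt k)]
    exact hc k

theorem exists_countable_approxKatetovExtension :
    ∃ (D : Type) (_ : PseudoMetricSpace D), Countable D ∧ ApproxKatetovExtension D := by
  obtain ⟨d, hd, hdq⟩ := exists_pseudoDist_nat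
  refine ⟨ℕ, hd.toPseudoMetricSpace, inferInstance, fun F hF A hA ε hε => ?_⟩
  have h1 : ∀ x y, F x ≤ F y + d x y := @IsKatetov.le_add_dist ℕ hd.toPseudoMetricSpace F hF
  have h2 : ∀ x y, d x y ≤ F x + F y := @IsKatetov.dist_le_add ℕ hd.toPseudoMetricSpace F hF
  obtain ⟨b, hb⟩ := hA.bddAbove
  -- Rounding `F` up keeps the radii compatible, and `F`, being 1-Lipschitz and below `q`, lies
  -- below the largest choice realised by `N`.
  choose q hq using fun x => exists_rat_btwn (show F x < F x + ε by linarith)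
  obtain ⟨N, hN⟩ := hdq (b + 1) (fun i => q i) fun i j => by
    linarith [h2 i j, (hq i).1, (hq j).1]
  refine ⟨N, fun a ha => ?_⟩
  obtain ⟨h3, h4⟩ := hN ⟨a, Nat.lt_succ_of_le (hb ha)⟩
  have h5 := h4 (F a) fun k => by linarith [h1 a k, (hq k).1]
  have h6 : d N a ≤ q a := h3
  have h7 : F a ≤ d N a := h5
  have h8 : |d N a - F a| ≤ ε := abs_le.2 ⟨by linarith, by linarith [(hq a).2]⟩
  exact h8

theorem exists_isUrysohnSpace : ∃ (U : Type) (_ : MetricSpace U), IsUrysohnSpace U := by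
  obtain ⟨D, _, _, hD⟩ := exists_countable_approxKatetovExtension
  exact ⟨UniformSpace.Completion D, inferInstance, (hD.of_denseRange
    UniformSpace.Completion.coe_isometry
    UniformSpace.Completion.denseRange_coe).katetovExtension.isUrysohnSpace⟩

theorem mainTheorem2 :
    (∃ (U : Type) (_ : MetricSpace U), IsUrysohnSpace U) ∧
    ∀ (U : Type*) [MetricSpace U], IsUrysohnSpace U →
      ∀ (X : Type*) [MetricSpace X] [CompleteSpace X] [TopologicalSpace.SeparableSpace X],
        List.TFAE [IsNonExpansiveRetract X U, FinitelyHyperconvex X,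
          InjectiveForFiniteMetricSpaces X] := by
  refine ⟨exists_isUrysohnSpace, fun U _ hU X _ _ _ => ?_⟩
  have := hU.complete
  have := hU.separable
  tfae_have 1 → 2 := fun h => h.finitelyHyperconvex hU.katetovExtension
  tfae_have 2 → 1 := fun h => h.isNonExpansiveRetract hU.katetovExtension
  tfae_have 2 → 3 := fun h => h.injectiveForFiniteMetricSpaces
  tfae_have 3 → 2 := fun h => h.finitelyHyperconvex
  tfae_finish
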